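/- The lucky numbers are produced by the following sieve. Let $\mathcal{L}_1$ be the set of all positive integers and let $\mathcal{L}_2$ be the set obtained from $\mathcal{L}_1$, listed in increasing order, by removing every second term, so that $\mathcal{L}_2 = \{1, 3, 5, 7, \dots\}$. For every integer $m \geq 2$, let $\ell_{m,n}$ denote the $n$th smallest element of $\mathcal{L}_m$, and let $\mathcal{L}_{m+1}$ be the set of all $\ell_{m,n}$ such that $n \geq 1$ is not divisible by $\ell_{m,m}$. The $n$th lucky number $\ell_n$ is $1$ if $n = 1$, and $\ell_{n,n}$ if $n \geq 2$; thus the sequence of lucky numbers is $1, 3, 7, 9, 13, 15, 21, 25, 31, 33, \dots$ **Theorem.** The inequality $$\ell_n > n \log n$$ holds for all integers $n \geq 1$; and the inequality $$\ell_n > n\left(\log n + \tfrac{1}{2} (\log\log n)^2 - \log\log n - 7.2\right)$$ holds for all integers $n > e^{e^{4.92}}$. -/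

import Mathlib

/-- The `n`th smallest element of a set `S` of natural numbers, with `n = 1, 2, 3, …`
(used only for infinite sets `S` and for `1 ≤ n`). -/
noncomputable def nthElement (S : Set ℕ) (n : ℕ) : ℕ :=
  Nat.nth (fun k => k ∈ S) (n - 1)

/-- The set obtained from `S` by listing its elements in increasing order, as a sequence indexed by
`n = 1, 2, 3, …`, and removing every `d`th term. -/
def removeEvery (d : ℕ) (S : Set ℕ) : Set ℕ :=
  {x | ∃ n : ℕ, 1 ≤ n ∧ ¬ d ∣ n ∧ x = nthElement S n}

/-- The successive sets of the lucky sieve, indexed by `m = 1, 2, 3, …`. The set number `1` consists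
of all positive integers; the set number `2` is obtained from it by removing every second term; and,
for `2 ≤ m`, the set number `m + 1` is obtained from the set number `m` by removing every `d`th
term, where `d` is the `m`th element of the set number `m`. (The index `0` is not used.) -/
noncomputable def luckySieve : ℕ → Set ℕ
  | 0 => {k | 1 ≤ k}
  | 1 => {k | 1 ≤ k}
  | 2 => removeEvery 2 {k | 1 ≤ k}
  | m + 3 => removeEvery (nthElement (luckySieve (m + 2)) (m + 2)) (luckySieve (m + 2))

/-- The `n`th lucky number, for `n = 1, 2, 3, …`: the `n`th element of the set number `n` of the
lucky sieve, an element that no later step of the sieve removes or moves to another place. The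
sequence starts with `1, 3, 7, 9, 13, 15, 21, 25, 31, 33`. -/
noncomputable def luckyNumber (n : ℕ) : ℕ :=
  nthElement (luckySieve n) n

/-!
Let `d_0 = 2, d_1 = 3, d_2 = 7, …` be the moduli of the successive steps of the sieve (`2`, and then
the lucky numbers), let `Q n` be the product of `d / (d - 1)` over the first `n` of them
(`sieveProd`), and `W t` the product over those with `d ≤ t` (`prodUpTo`). Undoing the steps of the
sieve one by one moves the position `x` to `x + ⌊(x - 1) / (d - 1)⌋`, and `ℓ_n` is what becomes of
the position `n`; only the steps with `d ≤ n` matter. Ignoring the rounding gives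
`ℓ_n - 1 ≤ (n - 1) * W n` (`luckyNumber_sub_one_le`). The rounding costs at most `1` per step,
magnified by the steps that are undone later, and by summation by parts this gives
`ℓ_n ≥ ∑ t < n, W t + W n - 1` (`sum_prodUpTo_le_luckyNumber`). Hence `W t ≥ 1 + log t` for all
`t ≥ 1` implies `ℓ_n > n log n`.

The upper bound for `ℓ_n` yields a growth law for the products themselves:
`Q (n + 1) - Q n ≥ (log (n + 1) - log n) * Q n / W (n + 1)` (`sieveProd_add_le_succ`). Since
`W ≤ Q`, this gives `Q n ≥ log n + c` at once, with a good constant `c` if the first few moduli are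
computed. The quotient `Q n / W (n + 1)` is in fact larger, by about `log h / W` with
`h = n / M ≥ log M`, where `M` is the number of moduli up to `n + 1`. With `s = log n` this makes
`Q` at least as large as a solution of `Q' = 1 + log s / s`, that is, `s + (log s) ^ 2 / 2` up to a
constant. The function `barrier` is an explicit lower bound of this form, and
`barrier_mul_le_log` is the inequality that allows the induction `barrier_succ_le`.

Finally `W n = Q M` for the number `M` of moduli up to `n`, and `n ≤ M * W (M + 1)`, so that
`log M` is about `log n - log log n`. This turns the lower bound for `Q` into `W n ≥ 1 + log n`
and, for large `n`, into the second-order bound.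
-/

/-! ### The lucky sieve in terms of positions -/

/-- The position, before the removal of every `d`th term, of the term that is at position `x`
afterwards (positions start from `1`). -/
def sieveMap (d x : ℕ) : ℕ := x + (x - 1) / (d - 1)

/-- The terms at positions not divisible by `d` are, in increasing order, those at the positions
`sieveMap d 1, sieveMap d 2, …`. -/
lemma removeEvery_spec {S : Set ℕ} (hS : S.Infinite) {d : ℕ} (hd : 2 ≤ d) :
    (removeEvery d S).Infinite ∧
      ∀ x, 1 ≤ x → nthElement (removeEvery d S) x = nthElement S (sieveMap d x) := by
  obtain ⟨e, rfl⟩ : ∃ e, d = e + 2 := ⟨d - 2, by omega⟩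
  set g : ℕ → ℕ := fun k => Nat.nth (fun k => k ∈ S) (k + k / (e + 1)) with hg
  have hgm : StrictMono g := by
    refine (Nat.nth_strictMono hS).comp fun a b hab => ?_
    have : a / (e + 1) ≤ b / (e + 1) := Nat.div_le_div_right hab.le
    exact add_lt_add_of_lt_of_le hab this
  have hrange : Set.range g = removeEvery (e + 2) S := by
    ext x
    constructor
    · rintro ⟨k, rfl⟩
      refine ⟨k + k / (e + 1) + 1, Nat.le_add_left _ _, ?_, by simp [nthElement, hg]⟩
      have h1 := Nat.div_add_mod k (e + 1)
      have h2 := Nat.mod_lt k (Nat.succ_pos e)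
      set q := k / (e + 1)
      set t := k % (e + 1)
      have : k + q + 1 = (t + 1) + (e + 2) * q := by rw [← h1]; ring
      rw [this, Nat.dvd_add_left (Dvd.intro _ rfl)]
      exact fun h => absurd (Nat.le_of_dvd (Nat.succ_pos t) h) (by omega)
    · rintro ⟨n, hn, hdn, rfl⟩
      have h1 := Nat.div_add_mod n (e + 2)
      have h2 := Nat.mod_lt n (show 0 < e + 2 by omega)
      have h3 : n % (e + 2) ≠ 0 := fun h => hdn (Nat.dvd_of_mod_eq_zero h)
      set q := n / (e + 2)
      obtain ⟨t, ht⟩ : ∃ t, n % (e + 2) = t + 1 := ⟨n % (e + 2) - 1, by omega⟩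
      rw [ht] at h1 h2
      refine ⟨t + (e + 1) * q, ?_⟩
      have hq : (t + (e + 1) * q) / (e + 1) = q := by
        rw [Nat.add_mul_div_left _ _ (Nat.succ_pos e), Nat.div_eq_of_lt (by omega), zero_add]
      simp only [hg, nthElement, hq]
      congr 1
      rw [← h1, ← add_assoc, Nat.add_sub_cancel]
      ring
  have hinf : (removeEvery (e + 2) S).Infinite := hrange ▸ Set.infinite_range_of_injective
    hgm.injective
  refine ⟨hinf, fun x hx => ?_⟩
  have hnth : Nat.nth (fun k => k ∈ removeEvery (e + 2) S) = g := by
    refine ((Nat.nth_strictMono hinf).range_inj hgm).1 ?_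
    rw [hrange]
    exact Nat.range_nth_of_infinite hinf
  obtain ⟨k, rfl⟩ : ∃ k, x = k + 1 := ⟨x - 1, by omega⟩
  have : k + 1 + k / (e + 1) - 1 = k + k / (e + 1) := by
    rw [add_right_comm, Nat.add_sub_cancel]
  simp [nthElement, hnth, hg, sieveMap, this]

/-- The number `d` such that step `i` of the sieve, with `i = 0, 1, 2, …`, removes every `d`th
term: `2`, and after it the lucky numbers `3, 7, 9, …`. -/
noncomputable def sieveModulus (i : ℕ) : ℕ := if i = 0 then 2 else luckyNumber (i + 1)

/-- The term at position `x` after the first `m` steps of the sieve. -/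
noncomputable def sieveValue : ℕ → ℕ → ℕ
  | 0, x => x
  | m + 1, x => sieveValue m (sieveMap (sieveModulus m) x)

lemma le_sieveMap (d x : ℕ) : x ≤ sieveMap d x := Nat.le_add_right _ _

lemma sieveMap_strictMono (d : ℕ) : StrictMono (sieveMap d) := fun a b hab => by
  have : (a - 1) / (d - 1) ≤ (b - 1) / (d - 1) := Nat.div_le_div_right (by omega)
  unfold sieveMap
  omega

lemma sieveValue_strictMono (m : ℕ) : StrictMono (sieveValue m) := by
  induction m with
  | zero => exact strictMono_id
  | succ m ih => exact ih.comp (sieveMap_strictMono _)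

lemma le_sieveValue (m x : ℕ) : x ≤ sieveValue m x := (sieveValue_strictMono m).le_apply

lemma nthElement_pos_nat {x : ℕ} (hx : 1 ≤ x) : nthElement {k | 1 ≤ k} x = x := by
  have hinf : {k : ℕ | 1 ≤ k}.Infinite := Set.infinite_of_injective_forall_mem
    (Nat.succ_injective) fun k => Nat.succ_pos k
  have : Nat.nth (fun k : ℕ => 1 ≤ k) = Nat.succ := by
    refine ((Nat.nth_strictMono hinf).range_inj (fun a b h => Nat.succ_lt_succ h)).1 ?_
    rw [Nat.range_nth_of_infinite hinf]
    ext k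
    simp [Nat.one_le_iff_ne_zero]
  simp only [nthElement, Set.mem_ofPred_eq, this]
  omega

lemma luckySieve_succ_succ (m : ℕ) :
    luckySieve (m + 2) = removeEvery (sieveModulus m) (luckySieve (m + 1)) := by
  cases m with
  | zero => simp [luckySieve, sieveModulus]
  | succ m => simp [luckySieve, sieveModulus, luckyNumber]

lemma luckySieve_spec (m : ℕ) : (luckySieve (m + 1)).Infinite ∧
    (∀ x, 1 ≤ x → nthElement (luckySieve (m + 1)) x = sieveValue m x) ∧ 2 ≤ sieveModulus m := by
  induction m with
  | zero =>
    refine ⟨?_, fun x hx => ?_, by simp [sieveModulus]⟩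
    · exact Set.infinite_of_injective_forall_mem (f := Nat.succ) Nat.succ_injective
        fun k => Nat.succ_pos k
    · simpa [luckySieve, sieveValue] using nthElement_pos_nat hx
  | succ m ih =>
    obtain ⟨h1, h2, h3⟩ := ih
    have h := removeEvery_spec h1 h3
    rw [← luckySieve_succ_succ] at h
    have hval : ∀ x, 1 ≤ x → nthElement (luckySieve (m + 2)) x = sieveValue (m + 1) x :=
      fun x hx => by rw [h.2 x hx, h2 _ (hx.trans (le_sieveMap _ _)), sieveValue]
    refine ⟨h.1, hval, ?_⟩
    have := le_sieveValue (m + 1) (m + 2)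
    rw [← hval _ (by omega)] at this
    exact (Nat.le_add_left 2 m).trans this

lemma luckyNumber_succ (n : ℕ) : luckyNumber (n + 1) = sieveValue n (n + 1) :=
  (luckySieve_spec n).2.1 _ (Nat.succ_pos n)

lemma sieveModulus_zero : sieveModulus 0 = 2 := rfl

lemma sieveModulus_succ (i : ℕ) : sieveModulus (i + 1) = sieveValue (i + 1) (i + 2) :=
  luckyNumber_succ (i + 1)

lemma sieveModulus_strictMono : StrictMono sieveModulus := by
  refine strictMono_nat_of_lt_succ fun i => ?_
  cases i with
  | zero =>
    rw [sieveModulus_zero, sieveModulus_succ]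
    simp [sieveValue, sieveMap, sieveModulus_zero]
  | succ i =>
    rw [sieveModulus_succ, sieveModulus_succ]
    exact (sieveValue_strictMono _ (Nat.lt_succ_self _)).trans_le
      ((sieveValue_strictMono _).monotone (le_sieveMap _ _))

lemma add_two_le_sieveModulus (i : ℕ) : i + 2 ≤ sieveModulus i := by
  induction i with
  | zero => simp [sieveModulus_zero]
  | succ i ih =>
    exact Nat.succ_le_of_lt (ih.trans_lt (sieveModulus_strictMono (Nat.lt_succ_self i)))

/-- The number of steps of the sieve whose modulus is at most `t`, that is, of the steps that move
the term at position `t`. -/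
noncomputable def moduliUpTo (t : ℕ) : ℕ :=
  Nat.find (p := fun i => t < sieveModulus i) ⟨t, by have := add_two_le_sieveModulus t; omega⟩

lemma lt_sieveModulus_iff {t i : ℕ} : t < sieveModulus i ↔ moduliUpTo t ≤ i := by
  constructor
  · intro h
    exact Nat.find_min' _ h
  · intro h
    have h1 : t < sieveModulus (moduliUpTo t) := Nat.find_spec (p := fun i => t < sieveModulus i) _
    exact h1.trans_le (sieveModulus_strictMono.monotone h)

lemma sieveModulus_le_iff {t i : ℕ} : sieveModulus i ≤ t ↔ i < moduliUpTo t := by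
  rw [← not_lt, lt_sieveModulus_iff, not_le]

lemma moduliUpTo_mono : Monotone moduliUpTo := fun _ _ h =>
  lt_sieveModulus_iff.1 (h.trans_lt (lt_sieveModulus_iff.2 le_rfl))

lemma moduliUpTo_succ_le (n : ℕ) : moduliUpTo (n + 1) ≤ n :=
  lt_sieveModulus_iff.1 (by have := add_two_le_sieveModulus n; omega)

lemma sieveMap_eq_self {d x : ℕ} (h : x < d) : sieveMap d x = x := by
  rw [sieveMap, Nat.add_eq_left, Nat.div_eq_zero_iff]
  omega

/-- Steps whose modulus exceeds `x` do not move the term at position `x`. -/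
lemma sieveValue_eq {m x : ℕ} (h : moduliUpTo x ≤ m) :
    sieveValue m x = sieveValue (moduliUpTo x) x := by
  induction m, h using Nat.le_induction with
  | base => rfl
  | succ m hm ih => rw [sieveValue, sieveMap_eq_self (lt_sieveModulus_iff.2 hm), ih]

lemma luckyNumber_eq {n : ℕ} (hn : 1 ≤ n) :
    luckyNumber n = sieveValue (moduliUpTo n) n := by
  obtain ⟨n, rfl⟩ : ∃ k, n = k + 1 := ⟨n - 1, by omega⟩
  rw [luckyNumber_succ, sieveValue_eq (moduliUpTo_succ_le n)]

/-! ### Upper and lower bounds for lucky numbers by products over the moduli -/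

/-- The product of `d / (d - 1)` over the moduli `d` of the first `m` steps of the sieve: the
reciprocal of the density of the set that these steps leave. -/
noncomputable def sieveProd (m : ℕ) : ℝ :=
  ∏ i ∈ Finset.range m, (sieveModulus i : ℝ) / ((sieveModulus i : ℝ) - 1)

/-- The product of `d / (d - 1)` over the moduli `d ≤ t` of the sieve. -/
noncomputable def prodUpTo (t : ℕ) : ℝ := sieveProd (moduliUpTo t)

lemma one_lt_sieveModulus (i : ℕ) : (1 : ℝ) < sieveModulus i := by
  have := add_two_le_sieveModulus i
  exact_mod_cast (by omega : 1 < sieveModulus i)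

lemma sieveProd_zero : sieveProd 0 = 1 := by simp [sieveProd]

lemma sieveProd_succ (m : ℕ) : sieveProd (m + 1) =
    sieveProd m * ((sieveModulus m : ℝ) / ((sieveModulus m : ℝ) - 1)) :=
  Finset.prod_range_succ _ _

lemma sieveProd_pos (m : ℕ) : 0 < sieveProd m :=
  Finset.prod_pos fun i _ => div_pos (by linarith [one_lt_sieveModulus i])
    (by linarith [one_lt_sieveModulus i])

lemma sieveProd_succ_sub (m : ℕ) :
    sieveProd (m + 1) - sieveProd m = sieveProd m / ((sieveModulus m : ℝ) - 1) := by
  have : (sieveModulus m : ℝ) - 1 ≠ 0 := by linarith [one_lt_sieveModulus m]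
  rw [sieveProd_succ]
  field_simp
  ring

lemma sieveProd_mono : Monotone sieveProd := by
  refine monotone_nat_of_le_succ fun m => ?_
  rw [← sub_nonneg, sieveProd_succ_sub]
  exact div_nonneg (sieveProd_pos m).le (by linarith [one_lt_sieveModulus m])

lemma one_le_sieveProd (m : ℕ) : 1 ≤ sieveProd m :=
  sieveProd_zero ▸ sieveProd_mono (Nat.zero_le m)

lemma one_le_prodUpTo (t : ℕ) : 1 ≤ prodUpTo t := one_le_sieveProd _

lemma prodUpTo_succ_le (n : ℕ) : prodUpTo (n + 1) ≤ sieveProd n :=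
  sieveProd_mono (moduliUpTo_succ_le n)

/-- Without the rounding, `sieveMap d x - 1` would be `(x - 1) * (d / (d - 1))`. -/
lemma sieveMap_sub_one_le {d x : ℕ} (hd : 2 ≤ d) (hx : 1 ≤ x) :
    (sieveMap d x : ℝ) - 1 ≤ ((x : ℝ) - 1) * ((d : ℝ) / ((d : ℝ) - 1)) := by
  obtain ⟨y, rfl⟩ : ∃ y, x = y + 1 := ⟨x - 1, by omega⟩
  obtain ⟨e, rfl⟩ : ∃ e, d = e + 2 := ⟨d - 2, by omega⟩
  have h : ((y / (e + 1) : ℕ) : ℝ) ≤ (y : ℝ) / ((e + 1 : ℕ) : ℝ) := Nat.cast_div_le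
  have he : (0 : ℝ) < (e : ℝ) + 1 := by positivity
  have h2 : ((y : ℝ) + 1 - 1) * (((e : ℝ) + 2) / ((e : ℝ) + 2 - 1)) = y + y / ((e : ℝ) + 1) := by
    have : (e : ℝ) + 2 - 1 = e + 1 := by ring
    rw [this]
    field_simp
    ring
  push_cast [sieveMap, Nat.add_sub_cancel, show e + 2 - 1 = e + 1 from rfl] at h ⊢
  rw [h2]
  linarith

/-- The rounding in `sieveMap` costs at most `1`. -/
lemma le_sieveMap_add_one {d x : ℕ} (hd : 2 ≤ d) (hx : 1 ≤ x) :
    (x : ℝ) * ((d : ℝ) / ((d : ℝ) - 1)) - 1 ≤ (sieveMap d x : ℝ) := by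
  obtain ⟨y, rfl⟩ : ∃ y, x = y + 1 := ⟨x - 1, by omega⟩
  obtain ⟨e, rfl⟩ : ∃ e, d = e + 2 := ⟨d - 2, by omega⟩
  have he : (0 : ℝ) < (e : ℝ) + 1 := by positivity
  have h : y + 1 ≤ (y / (e + 1) + 1) * (e + 1) := by
    have h1 := Nat.div_add_mod y (e + 1)
    have h2 : y % (e + 1) < e + 1 := Nat.mod_lt y (Nat.succ_pos e)
    rw [add_one_mul, mul_comm]
    omega
  have h' : ((y : ℝ) + 1) / ((e : ℝ) + 1) ≤ ((y / (e + 1) : ℕ) : ℝ) + 1 := by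
    rw [div_le_iff₀ he]
    exact_mod_cast h
  have h2 : ((y : ℝ) + 1) * (((e : ℝ) + 2) / ((e : ℝ) + 2 - 1)) =
      y + 1 + (y + 1) / ((e : ℝ) + 1) := by
    have : (e : ℝ) + 2 - 1 = e + 1 := by ring
    rw [this]
    field_simp
    ring
  push_cast [sieveMap, Nat.add_sub_cancel, show e + 2 - 1 = e + 1 from rfl] at h' ⊢
  rw [h2]
  linarith

lemma sieveValue_sub_one_le (m : ℕ) {x : ℕ} (hx : 1 ≤ x) :
    (sieveValue m x : ℝ) - 1 ≤ ((x : ℝ) - 1) * sieveProd m := by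
  induction m generalizing x with
  | zero => simp [sieveValue, sieveProd_zero]
  | succ m ih =>
    rw [sieveValue, sieveProd_succ]
    have hd : 2 ≤ sieveModulus m := by have := add_two_le_sieveModulus m; omega
    calc _ ≤ ((sieveMap (sieveModulus m) x : ℝ) - 1) * sieveProd m :=
          ih (hx.trans (le_sieveMap _ _))
      _ ≤ ((x : ℝ) - 1) * ((sieveModulus m : ℝ) / ((sieveModulus m : ℝ) - 1)) * sieveProd m :=
          mul_le_mul_of_nonneg_right (sieveMap_sub_one_le hd hx) (sieveProd_pos m).le
      _ = _ := by ring

/-- The rounding error of step `i`, at most `1`, is magnified by the steps before it, that is, by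
the factor `sieveProd i`. -/
lemma le_sieveValue_add_sum (m : ℕ) {x : ℕ} (hx : 1 ≤ x) :
    (x : ℝ) * sieveProd m - ∑ i ∈ Finset.range m, sieveProd i ≤ (sieveValue m x : ℝ) := by
  induction m generalizing x with
  | zero => simp [sieveValue, sieveProd_zero]
  | succ m ih =>
    rw [sieveValue, sieveProd_succ, Finset.sum_range_succ]
    have hd : 2 ≤ sieveModulus m := by have := add_two_le_sieveModulus m; omega
    refine le_trans ?_ (ih (hx.trans (le_sieveMap _ _)))
    have := mul_le_mul_of_nonneg_right (le_sieveMap_add_one hd hx) (sieveProd_pos m).le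
    linarith

lemma luckyNumber_sub_one_le {n : ℕ} (hn : 1 ≤ n) :
    (luckyNumber n : ℝ) - 1 ≤ ((n : ℝ) - 1) * prodUpTo n :=
  luckyNumber_eq hn ▸ sieveValue_sub_one_le _ hn

lemma le_luckyNumber_add_sum {n : ℕ} (hn : 1 ≤ n) :
    (n : ℝ) * prodUpTo n - ∑ i ∈ Finset.range (moduliUpTo n), sieveProd i ≤ luckyNumber n :=
  luckyNumber_eq hn ▸ le_sieveValue_add_sum _ hn

lemma moduliUpTo_zero : moduliUpTo 0 = 0 :=
  Nat.le_zero.1 (lt_sieveModulus_iff.1 (by simp [sieveModulus_zero]))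

/-- Summation by parts: both sides grow by `prodUpTo n` from `n` to `n + 1`; where `n + 1` is a
modulus `d` this is because the product then grows by its `1 / (d - 1)`th part. -/
lemma sum_prodUpTo (n : ℕ) : ∑ t ∈ Finset.range n, prodUpTo t =
    ((n : ℝ) - 1) * prodUpTo n - ∑ i ∈ Finset.range (moduliUpTo n), sieveProd i + 1 := by
  induction n with
  | zero => simp [prodUpTo, moduliUpTo_zero, sieveProd_zero]
  | succ n ih =>
    rw [Finset.sum_range_succ, ih]
    have hmono := moduliUpTo_mono (Nat.le_succ n)
    have hlt : n < sieveModulus (moduliUpTo n) := lt_sieveModulus_iff.2 le_rfl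
    rcases eq_or_ne (sieveModulus (moduliUpTo n)) (n + 1) with h | h
    · have h1 : moduliUpTo (n + 1) = moduliUpTo n + 1 := by
        apply le_antisymm
        · rw [← lt_sieveModulus_iff]
          have := sieveModulus_strictMono (Nat.lt_succ_self (moduliUpTo n))
          rw [h] at this
          exact this
        · exact sieveModulus_le_iff.1 h.le
      have h2 := sieveProd_succ_sub (moduliUpTo n)
      have hn : (n : ℝ) ≠ 0 := by
        rintro h0
        have h0 : n = 0 := by exact_mod_cast h0
        have := add_two_le_sieveModulus (moduliUpTo n)
        omega
      rw [h] at h2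
      push_cast at h2
      rw [add_sub_cancel_right, eq_div_iff hn] at h2
      rw [prodUpTo, prodUpTo, h1, Finset.sum_range_succ]
      push_cast
      linear_combination -h2
    · have h1 : moduliUpTo (n + 1) = moduliUpTo n :=
        le_antisymm (lt_sieveModulus_iff.1 (by omega)) hmono
      rw [prodUpTo, prodUpTo, h1]
      push_cast
      ring

/-- A discrete form of `∫ W ≤ ℓ_n`, with `W` the product over the moduli up to `t`; the total
rounding error is exactly the difference between `n * W n` and the integral. -/
lemma sum_prodUpTo_le_luckyNumber {n : ℕ} (hn : 1 ≤ n) :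
    ∑ t ∈ Finset.range n, prodUpTo t + prodUpTo n - 1 ≤ luckyNumber n := by
  have := le_luckyNumber_add_sum hn
  rw [sum_prodUpTo]
  linarith

lemma sieveModulus_sub_one_le {n : ℕ} (hn : 1 ≤ n) :
    (sieveModulus n : ℝ) - 1 ≤ (n : ℝ) * prodUpTo (n + 1) := by
  have := luckyNumber_sub_one_le (Nat.succ_pos n)
  rw [sieveModulus, if_neg (by omega)]
  simpa using this

lemma log_succ_sub_log_le {n : ℕ} (hn : 1 ≤ n) :
    Real.log ((n + 1 : ℕ) : ℝ) - Real.log n ≤ 1 / n := by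
  have h0 : (0 : ℝ) < n := by exact_mod_cast hn
  rw [← Real.log_div (by positivity) h0.ne']
  refine (Real.log_le_sub_one_of_pos (by positivity)).trans (le_of_eq ?_)
  push_cast
  field_simp
  ring

/-- The product grows at least as fast as the solution of `dQ/ds = Q / W`, where `s = log n` and
`W` is the product over the moduli up to `n`. -/
lemma sieveProd_add_le_succ {n : ℕ} (hn : 1 ≤ n) :
    sieveProd n + (Real.log ((n + 1 : ℕ) : ℝ) - Real.log n) * (sieveProd n / prodUpTo (n + 1)) ≤
      sieveProd (n + 1) := by
  have h0 : (0 : ℝ) < n := by exact_mod_cast hn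
  have hA : 0 < prodUpTo (n + 1) := by linarith [one_le_prodUpTo (n + 1)]
  have hQ := sieveProd_pos n
  have h1 := sieveProd_succ_sub n
  have h2 : sieveProd n / ((n : ℝ) * prodUpTo (n + 1)) ≤
      sieveProd n / ((sieveModulus n : ℝ) - 1) :=
    div_le_div_of_nonneg_left hQ.le (by linarith [one_lt_sieveModulus n])
      (sieveModulus_sub_one_le hn)
  have h3 := mul_le_mul_of_nonneg_right (log_succ_sub_log_le hn) (div_pos hQ hA).le
  have h4 : 1 / (n : ℝ) * (sieveProd n / prodUpTo (n + 1)) =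
      sieveProd n / ((n : ℝ) * prodUpTo (n + 1)) := by field_simp
  linarith

lemma sieveProd_sub_log_mono {k n : ℕ} (hk : 1 ≤ k) (hkn : k ≤ n) :
    sieveProd k - Real.log k ≤ sieveProd n - Real.log n := by
  induction n, hkn using Nat.le_induction with
  | base => rfl
  | succ n hn ih =>
    have h1 := sieveProd_add_le_succ (hk.trans hn)
    have hA : 0 < prodUpTo (n + 1) := by linarith [one_le_prodUpTo (n + 1)]
    have h2 : 1 ≤ sieveProd n / prodUpTo (n + 1) := by
      rw [one_le_div hA]
      exact prodUpTo_succ_le n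
    have h3 : 0 ≤ Real.log ((n + 1 : ℕ) : ℝ) - Real.log n :=
      sub_nonneg.2 (Real.log_le_log (by exact_mod_cast hk.trans hn) (by simp))
    nlinarith

lemma moduliUpTo_pos {n : ℕ} (hn : 2 ≤ n) : 1 ≤ moduliUpTo n :=
  sieveModulus_le_iff.1 (by rw [sieveModulus_zero]; exact hn)

/-- If `M` of the moduli are at most `n`, then `n` is below the next one, which is the lucky number
with index `M + 1`. -/
lemma le_moduliUpTo_mul {n : ℕ} (hn : 2 ≤ n) :
    (n : ℝ) ≤ moduliUpTo n * prodUpTo (moduliUpTo n + 1) := by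
  have h1 := sieveModulus_sub_one_le (moduliUpTo_pos hn)
  have h2 : n < sieveModulus (moduliUpTo n) := lt_sieveModulus_iff.2 le_rfl
  have h3 : (n : ℝ) + 1 ≤ sieveModulus (moduliUpTo n) := by exact_mod_cast h2
  linarith

/-! ### Numerical values of the products -/

/-- The moduli of the first `m` steps of the sieve, the last one first, in computable form. -/
def moduliList : ℕ → List ℕ
  | 0 => []
  | m + 1 =>
    (if m = 0 then 2 else (moduliList m).foldl (fun x d => sieveMap d x) (m + 1)) :: moduliList m

lemma foldl_moduliList (m x : ℕ) :
    (moduliList m).foldl (fun x d => sieveMap d x) x = sieveValue m x ∧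
      moduliList (m + 1) = sieveModulus m :: moduliList m := by
  induction m generalizing x with
  | zero => simp [moduliList, sieveValue, sieveModulus_zero]
  | succ m ih =>
    have h : ∀ x, (moduliList (m + 1)).foldl (fun x d => sieveMap d x) x =
        sieveValue (m + 1) x := fun x => by
      rw [(ih x).2, List.foldl_cons, (ih _).1, sieveValue]
    refine ⟨h x, ?_⟩
    rw [sieveModulus_succ, ← h (m + 2), moduliList, if_neg (Nat.succ_ne_zero m)]

/-- Clears the denominators of `sieveProd m`, which makes numerical bounds decidable in `ℕ`. -/
lemma sieveProd_mul_prod_moduliList (m : ℕ) :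
    sieveProd m * (((moduliList m).map (· - 1)).prod : ℕ) = ((moduliList m).prod : ℕ) := by
  induction m with
  | zero => simp [sieveProd_zero, moduliList]
  | succ m ih =>
    have h1 := one_lt_sieveModulus m
    have h2 : (sieveModulus m : ℝ) - 1 ≠ 0 := by linarith
    rw [(foldl_moduliList m 0).2, sieveProd_succ, List.map_cons, List.prod_cons, List.prod_cons]
    rw [Nat.cast_mul, Nat.cast_mul, ← ih,
      Nat.cast_sub (show 1 ≤ sieveModulus m by exact_mod_cast h1.le), Nat.cast_one]
    field_simp

lemma le_sieveProd_of_moduliList {m a b : ℕ} (hb : 0 < b)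
    (h : a * ((moduliList m).map (· - 1)).prod ≤ b * (moduliList m).prod) :
    (a : ℝ) / b ≤ sieveProd m := by
  have hpos : 0 < ((moduliList m).map (· - 1)).prod := by
    refine Nat.pos_of_ne_zero fun h0 => ?_
    have h1 := sieveProd_mul_prod_moduliList m
    have h2 : ∀ m, 0 < (moduliList m).prod := fun m => by
      induction m with
      | zero => simp [moduliList]
      | succ m ih =>
        rw [(foldl_moduliList m 0).2, List.prod_cons]
        have := add_two_le_sieveModulus m
        exact Nat.mul_pos (by omega) ih
    rw [h0, Nat.cast_zero, mul_zero] at h1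
    exact (h2 m).ne (by exact_mod_cast h1)
  have hpos' : (0 : ℝ) < (((moduliList m).map (· - 1)).prod : ℕ) := by exact_mod_cast hpos
  rw [div_le_iff₀ (by exact_mod_cast hb), ← mul_le_mul_iff_left₀ hpos']
  calc (a : ℝ) * (((moduliList m).map (· - 1)).prod : ℕ)
      ≤ b * ((moduliList m).prod : ℕ) := by exact_mod_cast h
    _ = _ := by rw [← sieveProd_mul_prod_moduliList]; ring

lemma le_sieveProd_one : (2 : ℝ) ≤ sieveProd 1 := by
  simpa using le_sieveProd_of_moduliList (m := 1) (a := 2) (b := 1) one_pos (by decide +kernel)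

lemma le_sieveProd_three : (7 / 2 : ℝ) ≤ sieveProd 3 := by
  simpa using le_sieveProd_of_moduliList (m := 3) (a := 7) (b := 2) two_pos (by decide +kernel)

lemma le_sieveProd_five : (423 / 100 : ℝ) ≤ sieveProd 5 := by
  simpa using le_sieveProd_of_moduliList (m := 5) (a := 423) (b := 100) (by simp)
    (by decide +kernel)

lemma le_sieveProd_ten : (53 / 10 : ℝ) ≤ sieveProd 10 := by
  simpa using le_sieveProd_of_moduliList (m := 10) (a := 53) (b := 10) (by simp)
    (by decide +kernel)

lemma le_sieveProd_twenty : (63 / 10 : ℝ) ≤ sieveProd 20 := by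
  simpa using le_sieveProd_of_moduliList (m := 20) (a := 63) (b := 10) (by simp)
    (by decide +kernel)

lemma le_sieveProd_two_hundred : (97 / 10 : ℝ) ≤ sieveProd 200 := by
  simpa using le_sieveProd_of_moduliList (m := 200) (a := 97) (b := 10) (by simp)
    (by decide +kernel)

/-! ### The bound `1 + log n` for small `n`, and its consequences -/

lemma log_le_of_pow_le {y : ℝ} (hy : 0 < y) {p q : ℕ} (hq : 0 < q)
    (h : y ^ q ≤ (2.7182 : ℝ) ^ p) : Real.log y ≤ p / q := by
  rw [le_div_iff₀ (by exact_mod_cast hq), mul_comm, ← Real.log_pow]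
  refine (Real.log_le_iff_le_exp (by positivity)).2 (h.trans ?_)
  rw [← Real.exp_one_pow]
  exact pow_le_pow_left₀ (by norm_num) (by linarith [Real.exp_one_gt_d9]) p

lemma log_le_log_moduliUpTo_add {n : ℕ} (hn : 2 ≤ n) :
    Real.log n ≤ Real.log (moduliUpTo n) + Real.log (prodUpTo n) := by
  have hM : (0 : ℝ) < moduliUpTo n := by exact_mod_cast moduliUpTo_pos hn
  have hA : (0 : ℝ) < prodUpTo n := by linarith [one_le_prodUpTo n]
  rw [← Real.log_mul hM.ne' hA.ne']
  refine Real.log_le_log (by positivity) ((le_moduliUpTo_mul hn).trans ?_)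
  exact mul_le_mul_of_nonneg_left (prodUpTo_succ_le _) hM.le

lemma log_le_log_add_div {y T : ℝ} (hy : 0 < y) (hT : 0 < T) :
    Real.log y ≤ Real.log T + (y - T) / T := by
  have h := Real.log_le_sub_one_of_pos (div_pos hy hT)
  rw [Real.log_div hy.ne' hT.ne'] at h
  have : (y - T) / T = y / T - 1 := by field_simp
  linarith

/-- The bound `1 + log n ≤ prodUpTo n` over a range of `n`, from the value of one product. -/
lemma one_add_log_le_of_sieveProd {n k : ℕ} (hn : 2 ≤ n) (hk : 1 ≤ k) (hkM : k ≤ moduliUpTo n)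
    {T : ℝ} (hT : 1 ≤ T) (h1 : 1 + Real.log (T * k) ≤ sieveProd k)
    (h2 : Real.log (moduliUpTo n) + Real.log T ≤ T - 1) :
    1 + Real.log n ≤ prodUpTo n := by
  -- Otherwise `y = prodUpTo n` satisfies both `y < 1 + log M + log y`, from `n ≤ M * y`, and
  -- `y ≥ 1 + log M + log T`; compare `y` with `T`.
  by_contra! h
  have hk0 : (0 : ℝ) < k := by exact_mod_cast hk
  have h3 : sieveProd k - Real.log k ≤ prodUpTo n - Real.log (moduliUpTo n) :=
    sieveProd_sub_log_mono hk hkM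
  have h4 := log_le_log_moduliUpTo_add hn
  have hA := one_le_prodUpTo n
  rw [Real.log_mul (by positivity) hk0.ne'] at h1
  rcases le_total (prodUpTo n) T with hle | hle
  · have := Real.log_le_log (by linarith) hle
    linarith
  · have h5 := log_le_log_add_div (y := prodUpTo n) (by linarith) (show 0 < T by linarith)
    have h6 : (prodUpTo n - T) / T ≤ prodUpTo n - T := div_le_self (by linarith) hT
    linarith

lemma exp_three_bounds : (20.08 : ℝ) ≤ Real.exp 3 ∧ Real.exp 3 ≤ 20.1 := by
  have h : Real.exp 3 = Real.exp 1 ^ 3 := by rw [Real.exp_one_pow]; norm_num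
  rw [h]
  constructor
  · calc (20.08 : ℝ) ≤ 2.7182 ^ 3 := by norm_num
      _ ≤ _ := pow_le_pow_left₀ (by norm_num) (by linarith [Real.exp_one_gt_d9]) 3
  · calc _ ≤ (2.7183 : ℝ) ^ 3 :=
          pow_le_pow_left₀ (Real.exp_pos _).le (by linarith [Real.exp_one_lt_d9]) 3
      _ ≤ _ := by norm_num

/-- The bound `1 + log n ≤ prodUpTo n` where the number of moduli up to `n` is at most
`exp (exp 3)`: the products over the first `1, 3, 5, 10, 20, 200` moduli suffice. -/
lemma one_add_log_le_prodUpTo_of_le {n : ℕ} (hn : 1 ≤ n)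
    (hM : Real.log (moduliUpTo n) ≤ Real.exp 3) : 1 + Real.log n ≤ prodUpTo n := by
  rcases hn.eq_or_lt with rfl | hn
  · simpa using one_le_prodUpTo 1
  have hn : 2 ≤ n := hn
  have hM1 := moduliUpTo_pos hn
  have key : ∀ {N p q : ℕ} {T : ℝ}, 0 < q → 1 ≤ T → moduliUpTo n ≤ N →
      (N * T) ^ q ≤ (2.7182 : ℝ) ^ p → (p : ℝ) / q ≤ T - 1 →
      Real.log (moduliUpTo n) + Real.log T ≤ T - 1 := by
    intro N p q T hq hT hN h1 h2
    have hM0 : (0 : ℝ) < moduliUpTo n := by exact_mod_cast hM1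
    rw [← Real.log_mul hM0.ne' (by positivity)]
    refine le_trans (Real.log_le_log (by positivity) ?_)
      ((log_le_of_pow_le (y := N * T) ?_ hq h1).trans h2)
    · exact mul_le_mul_of_nonneg_right (by exact_mod_cast hN) (by linarith)
    · exact mul_pos (by exact_mod_cast hM1.trans hN) (by linarith)
  -- In each range `k ≤ M ≤ N` of `M = moduliUpTo n`, `T` is small enough for
  -- `1 + log (T * k) ≤ sieveProd k` and large enough for `log (N * T) ≤ T - 1`.
  rcases le_or_gt (moduliUpTo n) 2 with h | h2
  · refine one_add_log_le_of_sieveProd hn le_rfl hM1 (T := 2.7) (by norm_num) ?_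
      (key (N := 2) (p := 17) (q := 10) (by norm_num) (by norm_num) h (by norm_num) (by norm_num))
    have := log_le_of_pow_le (y := 2.7 * (1 : ℕ)) (p := 1) (q := 1) (by norm_num) (by norm_num)
      (by norm_num)
    norm_num at this ⊢
    linarith [le_sieveProd_one]
  rcases le_total (moduliUpTo n) 5 with h | h5
  · refine one_add_log_le_of_sieveProd hn (by norm_num) h2 (T := 4) (by norm_num) ?_
      (key (N := 5) (p := 3) (q := 1) (by norm_num) (by norm_num) h (by norm_num) (by norm_num))
    have := log_le_of_pow_le (y := 4 * (3 : ℕ)) (p := 5) (q := 2) (by norm_num) (by norm_num)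
      (by norm_num)
    norm_num at this ⊢
    linarith [le_sieveProd_three]
  rcases le_total (moduliUpTo n) 10 with h | h10
  · refine one_add_log_le_of_sieveProd hn (by norm_num) h5 (T := 5) (by norm_num) ?_
      (key (N := 10) (p := 4) (q := 1) (by norm_num) (by norm_num) h (by norm_num) (by norm_num))
    have := log_le_of_pow_le (y := 5 * (5 : ℕ)) (p := 29) (q := 9) (by norm_num) (by norm_num)
      (by norm_num)
    norm_num at this ⊢
    linarith [le_sieveProd_five]
  rcases le_total (moduliUpTo n) 50 with h | h50
  · refine one_add_log_le_of_sieveProd hn (by norm_num) h10 (T := 7) (by norm_num) ?_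
      (key (N := 50) (p := 6) (q := 1) (by norm_num) (by norm_num) h (by norm_num) (by norm_num))
    have := log_le_of_pow_le (y := 7 * (10 : ℕ)) (p := 43) (q := 10) (by norm_num) (by norm_num)
      (by norm_num)
    norm_num at this ⊢
    linarith [le_sieveProd_ten]
  rcases le_total (moduliUpTo n) 200 with h | h200
  · refine one_add_log_le_of_sieveProd hn (k := 20) (by norm_num) (by omega) (T := 10)
      (by norm_num) ?_
      (key (N := 200) (p := 9) (q := 1) (by norm_num) (by norm_num) h (by norm_num) (by norm_num))
    have := log_le_of_pow_le (y := 10 * (20 : ℕ)) (p := 53) (q := 10) (by norm_num) (by norm_num)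
      (by norm_num)
    norm_num at this ⊢
    linarith [le_sieveProd_twenty]
  · refine one_add_log_le_of_sieveProd hn (by norm_num) h200 (T := 26) (by norm_num) ?_ ?_
    · have := log_le_of_pow_le (y := 26 * (200 : ℕ)) (p := 87) (q := 10) (by norm_num)
        (by norm_num) (by norm_num)
      norm_num at this ⊢
      linarith [le_sieveProd_two_hundred]
    · have := log_le_of_pow_le (y := 26) (p := 4) (q := 1) (by norm_num)
        (by norm_num) (by norm_num)
      norm_num at this ⊢
      linarith [exp_three_bounds.2]

/-- Summing `1 + log t` over `t < n` gives `n * log n` up to terms of order `log n`, which the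
summand `prodUpTo n` compensates. -/
lemma mul_log_add_one_le_luckyNumber {n : ℕ} (hn : 1 ≤ n)
    (h : ∀ t, 1 ≤ t → t ≤ n → 1 + Real.log t ≤ prodUpTo t) :
    (n : ℝ) * Real.log n + 1 ≤ luckyNumber n := by
  have key : (n : ℝ) * Real.log n + 1 ≤ ∑ t ∈ Finset.range n, prodUpTo t + Real.log n := by
    induction n, hn using Nat.le_induction with
    | base => simpa using one_le_prodUpTo 0
    | succ n hn ih =>
      have h1 := ih fun t ht htn => h t ht (htn.trans n.le_succ)
      have h2 := h n hn n.le_succ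
      have h0 : (0 : ℝ) < n := by exact_mod_cast hn
      have h3 := mul_le_mul_of_nonneg_left (log_succ_sub_log_le hn) h0.le
      rw [mul_one_div_cancel h0.ne'] at h3
      rw [Finset.sum_range_succ]
      push_cast at h3 ⊢
      linarith
  have h1 := sum_prodUpTo_le_luckyNumber hn
  have h2 := h n hn le_rfl
  linarith

/-- The last modulus up to `n + 1` is a lucky number, to which `mul_log_add_one_le_luckyNumber`
applies; the summand `1` there turns `n + 1` into `n`. -/
lemma moduliUpTo_mul_log_le {n : ℕ} (hM : 2 ≤ moduliUpTo (n + 1))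
    (h : ∀ t, 1 ≤ t → t ≤ n → 1 + Real.log t ≤ prodUpTo t) :
    (moduliUpTo (n + 1) : ℝ) * Real.log (moduliUpTo (n + 1)) ≤ n := by
  obtain ⟨m, hm⟩ : ∃ m, moduliUpTo (n + 1) = m + 2 := ⟨moduliUpTo (n + 1) - 2, by omega⟩
  have h1 : sieveModulus (m + 1) ≤ n + 1 := sieveModulus_le_iff.2 (by omega)
  have h2 : luckyNumber (m + 2) ≤ n + 1 := h1
  have h3 := moduliUpTo_succ_le n
  have h4 := mul_log_add_one_le_luckyNumber (n := m + 2) (by omega)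
    fun t ht htm => h t ht (by omega)
  have h5 : (luckyNumber (m + 2) : ℝ) ≤ n + 1 := by exact_mod_cast h2
  rw [hm]
  linarith

/-! ### The comparison function -/

/-- The lower bound, as a function of `s = log n`, for the product over the first `n` moduli. The
main terms are `s + (log s) ^ 2 / 2`; the last term, a multiple of `1 / √s`, decreases fast enough
to absorb the errors of the differential inequality that the bound has to satisfy. -/
noncomputable def barrier (s : ℝ) : ℝ :=
  s + Real.log s ^ 2 / 2 - 15 / 4 + 16 * Real.exp (-(Real.log s / 2))

lemma hasDerivAt_barrier {s : ℝ} (hs : 0 < s) :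
    HasDerivAt barrier (1 + (Real.log s - 8 * Real.exp (-(Real.log s / 2))) / s) s := by
  have h1 := Real.hasDerivAt_log hs.ne'
  have h2 := (((hasDerivAt_id s).add ((h1.pow 2).div_const 2)).sub_const (15 / 4)).add
    (((h1.div_const 2).neg.exp).const_mul 16)
  refine h2.congr_deriv ?_
  simp only [Pi.neg_apply]
  field_simp
  ring

lemma three_le_log {s : ℝ} (hs : Real.exp 3 ≤ s) : 3 ≤ Real.log s :=
  (Real.le_log_iff_exp_le ((Real.exp_pos 3).trans_le hs)).2 hs

lemma exp_neg_bounds {v : ℝ} (hv : 3 ≤ v) :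
    0 < Real.exp (-(v / 2)) ∧ Real.exp (-(v / 2)) ≤ 0.224 ∧
      v ^ 3 * Real.exp (-(v / 2)) ≤ 10.76 := by
  have h3 : (Real.exp (-(v / 2))) ^ 2 ≤ 0.224 ^ 2 := by
    rw [← Real.exp_nat_mul]
    calc Real.exp ((2 : ℕ) * -(v / 2)) ≤ Real.exp (-3) := Real.exp_le_exp.2 (by push_cast; linarith)
      _ = (Real.exp 3)⁻¹ := Real.exp_neg 3
      _ ≤ (20.08 : ℝ)⁻¹ := inv_anti₀ (by norm_num) exp_three_bounds.1
      _ ≤ _ := by norm_num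
  refine ⟨Real.exp_pos _, le_of_sq_le_sq h3 (by norm_num), ?_⟩
  -- `v ^ 3 * exp (-v / 2)` is largest at `v = 6`, where it equals `216 / e ^ 3`.
  have h : v / 6 ≤ Real.exp (v / 6 - 1) := by linarith [Real.add_one_le_exp (v / 6 - 1)]
  have h' : (v / 6) ^ 3 ≤ Real.exp (v / 2) / Real.exp 3 := by
    refine (pow_le_pow_left₀ (by linarith) h 3).trans (le_of_eq ?_)
    rw [← Real.exp_nat_mul, ← Real.exp_sub]
    congr 1
    push_cast
    ring
  have he := exp_three_bounds.1
  rw [le_div_iff₀ (Real.exp_pos 3)] at h'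
  have h4 : (v / 6) ^ 3 * 20.08 ≤ Real.exp (v / 2) :=
    (mul_le_mul_of_nonneg_left he (by positivity)).trans h'
  have h5 := mul_le_mul_of_nonneg_right h4 (Real.exp_pos (-(v / 2))).le
  rw [← Real.exp_add, add_neg_cancel, Real.exp_zero] at h5
  have h6 : v ^ 3 * Real.exp (-(v / 2)) =
      216 * ((v / 6) ^ 3 * Real.exp (-(v / 2))) := by ring
  linarith

lemma barrier_monotoneOn : MonotoneOn barrier (Set.Ici (Real.exp 3)) := by
  have hpos : ∀ s ∈ Set.Ici (Real.exp 3), 0 < s := fun s hs => (Real.exp_pos 3).trans_le hs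
  refine monotoneOn_of_deriv_nonneg (convex_Ici _)
    (fun s hs => (hasDerivAt_barrier (hpos s hs)).continuousAt.continuousWithinAt)
    (fun s hs =>
      (hasDerivAt_barrier (hpos s (interior_subset hs))).differentiableAt.differentiableWithinAt)
    fun s hs => ?_
  have hs := interior_subset hs
  rw [(hasDerivAt_barrier (hpos s hs)).deriv]
  have h1 := three_le_log hs
  have h2 := exp_neg_bounds h1
  have : 0 ≤ (Real.log s - 8 * Real.exp (-(Real.log s / 2))) / s :=
    div_nonneg (by linarith) (hpos s hs).le
  linarith

/-- The differential inequality for `barrier`: its derivative at `s` is at most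
`1 + log h / barrier s` as soon as `h + log h` is essentially at least `s`. -/
lemma barrier_mul_le_log {s h : ℝ} (hs : Real.exp 3 ≤ s) (hh : 0 < h)
    (hsh : s - 1 / 100 ≤ h + Real.log h) :
    (Real.log s - 8 * Real.exp (-(Real.log s / 2))) / s * barrier s ≤ Real.log h := by
  have hs20 : 20 ≤ s := by linarith [exp_three_bounds.1]
  have hv := three_le_log hs
  obtain ⟨hr0, hr1, hr3⟩ := exp_neg_bounds hv
  have hlogh : Real.log s - 5 / 4 * ((Real.log s + 1 / 100) / s) ≤ Real.log h := by
    have hy0 : 0 ≤ (Real.log s + 1 / 100) / s := by positivity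
    rcases le_total s h with hle | hle
    · have := Real.log_le_log (by linarith) hle
      linarith
    · have h1 := Real.log_le_log hh hle
      have hy : (Real.log s + 1 / 100) / s ≤ 1 / 5 := by
        rw [div_le_iff₀ (by linarith)]
        have h2 := log_le_log_add_div (y := s) (T := 20) (by linarith) (by norm_num)
        have h3 := log_le_of_pow_le (y := 20) (p := 3) (q := 1) (by norm_num) (by norm_num)
          (by norm_num)
        norm_num at h3
        linarith
      set y := (Real.log s + 1 / 100) / s with hydef
      have hys : s * y = Real.log s + 1 / 100 := by rw [hydef]; field_simp
      have h2 : s * (1 - y) ≤ h := by rw [mul_sub, hys]; linarith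
      have h3 : Real.log s + Real.log (1 - y) ≤ Real.log h := by
        rw [← Real.log_mul (by linarith) (by linarith)]
        exact Real.log_le_log (mul_pos (by linarith) (by linarith)) h2
      have h4 := Real.one_sub_inv_le_log_of_pos (show 0 < 1 - y by linarith)
      have h5 : (1 - y)⁻¹ ≤ 1 + 5 / 4 * y := by
        rw [inv_le_iff_one_le_mul₀ (by linarith)]
        nlinarith
      linarith
  refine le_trans ?_ hlogh
  have hr2 : s * Real.exp (-(Real.log s / 2)) ^ 2 = 1 := by
    rw [← Real.exp_nat_mul]
    nth_rewrite 1 [← Real.exp_log (show 0 < s by linarith)]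
    rw [← Real.exp_add, Real.exp_eq_one_iff]
    push_cast
    ring
  unfold barrier
  set v := Real.log s
  set r := Real.exp (-(v / 2))
  have hinv : s⁻¹ = r ^ 2 := (eq_inv_of_mul_eq_one_right hr2).symm
  rw [div_eq_mul_inv _ s, div_eq_mul_inv _ s, hinv]
  have hmain : (v - 8 * r) * (v ^ 2 / 2 - 15 / 4 + 16 * r) * r + 5 / 4 * (v + 1 / 100) * r ≤ 8 := by
    have h1 : r ^ 2 ≤ 1 / 19.9 := by nlinarith
    have h2 : v * (4 - v) ≤ 3 := by nlinarith
    have h3 : r ^ 2 * (4 * (v * (4 - v)) + 30) ≤ r ^ 2 * 42 :=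
      mul_le_mul_of_nonneg_left (by linarith) (sq_nonneg r)
    have h4 : 0 ≤ v * r := by positivity
    have h5 : 0 ≤ r ^ 3 := by positivity
    have h6 : 3 * r ≤ v * r := mul_le_mul_of_nonneg_right hv hr0.le
    nlinarith
  calc (v - 8 * r) * r ^ 2 * (s + v ^ 2 / 2 - 15 / 4 + 16 * r)
      = (v - 8 * r) * (s * r ^ 2) + (v - 8 * r) * (v ^ 2 / 2 - 15 / 4 + 16 * r) * r * r := by ring
    _ = v - 5 / 4 * ((v + 1 / 100) * r ^ 2) + r * ((v - 8 * r) * (v ^ 2 / 2 - 15 / 4 + 16 * r) * r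
          + 5 / 4 * (v + 1 / 100) * r - 8) := by rw [hr2]; ring
    _ ≤ _ := by
      have := mul_nonneg hr0.le (sub_nonneg.2 hmain)
      linarith

lemma barrier_le_add {s : ℝ} (hs : Real.exp 3 ≤ s) (hs' : s ≤ Real.exp 3 + 1 / 100) :
    barrier s ≤ s + 4.4 := by
  have he := exp_three_bounds.1
  have hv := three_le_log hs
  obtain ⟨-, hr1, -⟩ := exp_neg_bounds hv
  have h1 := log_le_log_add_div (y := s) (T := Real.exp 3) (by linarith) (by linarith)
  have h2 : (s - Real.exp 3) / Real.exp 3 ≤ 1 / 100 := by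
    rw [div_le_iff₀ (by linarith)]
    linarith
  rw [Real.log_exp] at h1
  unfold barrier
  nlinarith

lemma add_le_barrier {s : ℝ} (hs : Real.exp 3 ≤ s) : s + Real.log s + 1.25 ≤ barrier s := by
  -- The tangent of `exp (-v / 2)` at `v = 3` turns the claim into a quadratic inequality.
  have h1 : Real.exp (-(3 / 2)) * (1 - (Real.log s - 3) / 2) ≤ Real.exp (-(Real.log s / 2)) := by
    rw [show -(Real.log s / 2) = -(3 / 2) + -((Real.log s - 3) / 2) by ring, Real.exp_add]
    refine mul_le_mul_of_nonneg_left ?_ (Real.exp_pos _).le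
    linarith [Real.add_one_le_exp (-((Real.log s - 3) / 2))]
  have h2 : Real.exp (-(3 / 2)) ^ 2 = (Real.exp 3)⁻¹ := by
    rw [← Real.exp_nat_mul, ← Real.exp_neg]
    norm_num
  have h3 : (20.1 : ℝ)⁻¹ ≤ (Real.exp 3)⁻¹ := inv_anti₀ (Real.exp_pos 3) exp_three_bounds.2
  have h4 : (0.223 : ℝ) ≤ Real.exp (-(3 / 2)) := by
    refine le_of_sq_le_sq ?_ (Real.exp_pos _).le
    rw [h2]
    refine le_trans ?_ h3
    norm_num
  have h5 := (exp_neg_bounds le_rfl).2.1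
  have hv := three_le_log hs
  unfold barrier
  set v := Real.log s
  set c := Real.exp (-(3 / 2))
  nlinarith [sq_nonneg (v - 2.785), mul_nonneg (sub_nonneg.2 h4) (sub_nonneg.2 hv),
    mul_nonneg (sub_nonneg.2 h5) (sub_nonneg.2 hv)]

/-! ### Lower bounds for the products and the lucky numbers -/

lemma two_hundred_le_of_log {n : ℕ} (hn : Real.exp 3 ≤ Real.log n) : 200 ≤ n := by
  by_contra! h
  have h0 : (0 : ℝ) < n := by
    rcases Nat.eq_zero_or_pos n with rfl | h0
    · have := exp_three_bounds.1
      norm_num at hn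
      linarith
    · exact_mod_cast h0
  have h1 : Real.log n ≤ Real.log 200 := Real.log_le_log h0 (by exact_mod_cast h.le)
  have h2 := log_le_of_pow_le (y := 200) (p := 6) (q := 1) (by norm_num) (by norm_num)
    (by norm_num)
  norm_num at h2
  linarith [exp_three_bounds.1]

lemma two_le_moduliUpTo {n : ℕ} (hn : 3 ≤ n) : 2 ≤ moduliUpTo n := by
  refine sieveModulus_le_iff.1 (le_trans ?_ hn)
  rw [sieveModulus_succ]
  simp [sieveValue, sieveMap, sieveModulus_zero]

/-- With `M` the number of moduli up to `n + 1`, the quotient `h = n / M` satisfies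
`log n ≤ h + log h`, because `M * log M ≤ n`. -/
lemma log_sub_log_moduliUpTo_le {n : ℕ} (hn : 2 ≤ n)
    (hpre : ∀ t, 1 ≤ t → t ≤ n → 1 + Real.log t ≤ prodUpTo t) :
    Real.log n ≤ (n : ℝ) / moduliUpTo (n + 1) + Real.log ((n : ℝ) / moduliUpTo (n + 1)) := by
  have hM := two_le_moduliUpTo (show 3 ≤ n + 1 by omega)
  have hM0 : (0 : ℝ) < moduliUpTo (n + 1) := by exact_mod_cast (by omega)
  have hn0 : (0 : ℝ) < n := by exact_mod_cast (by omega)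
  have h1 := moduliUpTo_mul_log_le hM hpre
  have h2 : Real.log (moduliUpTo (n + 1)) ≤ (n : ℝ) / moduliUpTo (n + 1) := by
    rw [le_div_iff₀ hM0]
    linarith
  rw [Real.log_div hn0.ne' hM0.ne']
  linarith

/-- If `prodUpTo (n + 1)` already exceeds the barrier, so does `sieveProd n`, with room to spare.
Otherwise it is small, and then the quotient `sieveProd n / prodUpTo (n + 1)`, the growth
rate of the product, is large. So no upper bound for the product is needed. -/
lemma barrier_succ_le {n : ℕ} (hn : Real.exp 3 ≤ Real.log n)
    (hQ : barrier (Real.log n) ≤ sieveProd n)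
    (hpre : ∀ t, 1 ≤ t → t ≤ n → 1 + Real.log t ≤ prodUpTo t) :
    barrier (Real.log ((n + 1 : ℕ) : ℝ)) ≤ sieveProd (n + 1) := by
  have hn200 := two_hundred_le_of_log hn
  have hn0 : (200 : ℝ) ≤ n := by exact_mod_cast hn200
  have he := exp_three_bounds.1
  have hMn := moduliUpTo_succ_le n
  have hM := two_le_moduliUpTo (show 3 ≤ n + 1 by omega)
  have hM0 : (0 : ℝ) < moduliUpTo (n + 1) := by exact_mod_cast (by omega)
  have hh := log_sub_log_moduliUpTo_le (by omega) hpre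
  have hQA : prodUpTo (n + 1) + Real.log ((n : ℝ) / moduliUpTo (n + 1)) ≤ sieveProd n := by
    have : prodUpTo (n + 1) - _ ≤ _ := sieveProd_sub_log_mono (by omega) hMn
    rw [Real.log_div (by linarith) hM0.ne']
    linarith
  have hh0 : 0 < (n : ℝ) / moduliUpTo (n + 1) := div_pos (by linarith) hM0
  set h := (n : ℝ) / moduliUpTo (n + 1)
  have hA : 0 < prodUpTo (n + 1) := by linarith [one_le_prodUpTo (n + 1)]
  have hstep := sieveProd_add_le_succ (show 1 ≤ n by omega)
  have hlt : Real.log n < Real.log ((n + 1 : ℕ) : ℝ) :=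
    Real.log_lt_log (by linarith) (by push_cast; linarith)
  have hΔ : Real.log ((n + 1 : ℕ) : ℝ) - Real.log n ≤ 1 / 100 :=
    (log_succ_sub_log_le (by omega)).trans
      (one_div_le_one_div_of_le (by norm_num) (by linarith))
  set s := Real.log n
  set s' := Real.log ((n + 1 : ℕ) : ℝ)
  have hpos : ∀ x, s ≤ x → 0 < x := fun x hx => by linarith
  obtain ⟨ξ, ⟨hξ1, hξ2⟩, hξ⟩ := exists_hasDerivAt_eq_slope barrier _ hlt
    (fun x hx => (hasDerivAt_barrier (hpos x hx.1)).continuousAt.continuousWithinAt)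
    (fun x hx => hasDerivAt_barrier (hpos x hx.1.le))
  have hξe : Real.exp 3 ≤ ξ := hn.trans hξ1.le
  have hkey := barrier_mul_le_log hξe hh0 (by linarith)
  have hψ : 0 ≤ (Real.log ξ - 8 * Real.exp (-(Real.log ξ / 2))) / ξ := by
    have h1 := three_le_log hξe
    have h2 := exp_neg_bounds h1
    exact div_nonneg (by linarith) (hpos ξ hξ1.le).le
  set ψ := (Real.log ξ - 8 * Real.exp (-(Real.log ξ / 2))) / ξ
  rw [eq_div_iff (by linarith)] at hξ
  have hbmono : barrier s ≤ barrier ξ := barrier_monotoneOn hn hξe hξ1.le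
  have hb20 : 20 ≤ barrier ξ := by linarith [add_le_barrier hξe, three_le_log hξe]
  have hlogh : 1 ≤ Real.log h := by
    rw [Real.le_log_iff_exp_le hh0]
    by_contra! hlt
    have := Real.log_lt_log hh0 hlt
    rw [Real.log_exp] at this
    linarith [Real.exp_one_lt_d9]
  -- If `prodUpTo (n + 1)` is above the barrier, `sieveProd n` exceeds it by `log h ≥ 1`, more than
  -- the barrier grows in one step.
  rcases le_total (barrier s) (prodUpTo (n + 1)) with hle | hle
  · have h1 : sieveProd n ≤ sieveProd (n + 1) := sieveProd_mono n.le_succ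
    nlinarith
  · have h1 : 1 + ψ ≤ sieveProd n / prodUpTo (n + 1) := by
      rw [le_div_iff₀ hA]
      nlinarith
    have h2 := mul_le_mul_of_nonneg_left h1 (sub_nonneg.2 hlt.le)
    linarith

/-- If the product were below `1 + log n`, then `log n` would exceed `s = log M` by at most about
`log s`, where `M` is the number of moduli up to `n`, while the barrier exceeds `s + log s + 1`. -/
lemma one_add_log_le_of_barrier {n : ℕ} (hM : Real.exp 3 ≤ Real.log (moduliUpTo n)) (hn : 2 ≤ n)
    (hQ : barrier (Real.log (moduliUpTo n)) ≤ prodUpTo n) :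
    1 + Real.log n ≤ prodUpTo n := by
  by_contra! h
  have he := exp_three_bounds.1
  have h1 := log_le_log_moduliUpTo_add hn
  have h2 := add_le_barrier hM
  have hv := three_le_log hM
  set s := Real.log (moduliUpTo n)
  have hy : 0 < prodUpTo n := by linarith
  have h3 := log_le_log_add_div (y := prodUpTo n) (T := 25) hy (by norm_num)
  have h4 := log_le_of_pow_le (y := 25) (p := 29) (q := 9) (by norm_num) (by norm_num)
    (by norm_num)
  have h5 : prodUpTo n ≤ 1.22 * s := by
    norm_num at h4
    linarith
  have h6 := Real.log_le_log hy h5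
  rw [Real.log_mul (by norm_num) (by linarith)] at h6
  have h7 := log_le_of_pow_le (y := 1.22) (p := 1) (q := 5) (by norm_num) (by norm_num)
    (by norm_num)
  norm_num at h6 h7
  linarith

/-- Both bounds in one induction: each step of the first uses the second for smaller arguments, and
the second at `n` uses the first at the number of moduli up to `n`, which is less than `n`. -/
lemma barrier_le_sieveProd_and (n : ℕ) :
    (Real.exp 3 ≤ Real.log n → barrier (Real.log n) ≤ sieveProd n) ∧
      (1 ≤ n → 1 + Real.log n ≤ prodUpTo n) := by
  induction n using Nat.strong_induction_on with
  | _ n ih =>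
    constructor
    · intro hn
      have hn200 := two_hundred_le_of_log hn
      obtain ⟨m, rfl⟩ : ∃ m, n = m + 1 := ⟨n - 1, by omega⟩
      rcases le_or_gt (Real.exp 3) (Real.log m) with hm | hm
      · exact barrier_succ_le hm ((ih m m.lt_succ_self).1 hm)
          fun t ht htm => (ih t (Nat.lt_succ_of_le htm)).2 ht
      · have h1 := log_succ_sub_log_le (show 1 ≤ m by omega)
        have h2 : (1 : ℝ) / m ≤ 1 / 100 :=
          one_div_le_one_div_of_le (by norm_num) (by exact_mod_cast (by omega))
        have h3 := barrier_le_add hn (by linarith)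
        have h4 := sieveProd_sub_log_mono (by norm_num) hn200
        have h5 := log_le_of_pow_le (y := 200) (p := 53) (q := 10) (by norm_num) (by norm_num)
          (by norm_num)
        norm_num at h4 h5
        push_cast at h3 h4 ⊢
        linarith [le_sieveProd_two_hundred]
    · intro hn
      rcases le_total (Real.log (moduliUpTo n)) (Real.exp 3) with hM | hM
      · exact one_add_log_le_prodUpTo_of_le hn hM
      · have hMn : moduliUpTo n < n := by
          obtain ⟨m, rfl⟩ : ∃ m, n = m + 1 := ⟨n - 1, by omega⟩
          exact Nat.lt_succ_of_le (moduliUpTo_succ_le m)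
        exact one_add_log_le_of_barrier hM
          (by have := two_hundred_le_of_log hM; omega) ((ih _ hMn).1 hM)

lemma one_add_log_le_prodUpTo {n : ℕ} (hn : 1 ≤ n) : 1 + Real.log n ≤ prodUpTo n :=
  (barrier_le_sieveProd_and n).2 hn

/-- Bounds the total rounding error by `M * prodUpTo n`, with `M` the number of moduli up to `n`. -/
lemma sub_mul_prodUpTo_le_luckyNumber {n : ℕ} (hn : 1 ≤ n) :
    ((n : ℝ) - moduliUpTo n) * prodUpTo n ≤ luckyNumber n := by
  have h1 := le_luckyNumber_add_sum hn
  have h2 : ∑ i ∈ Finset.range (moduliUpTo n), sieveProd i ≤ moduliUpTo n * prodUpTo n := by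
    have := Finset.sum_le_card_nsmul (Finset.range (moduliUpTo n)) sieveProd (prodUpTo n)
      fun i hi => sieveProd_mono (Finset.mem_range.1 hi).le
    simpa using this
  linarith

/-- With `S = log n` and `V = log S`, numerical consequences of `V > 4.92`. -/
lemma exp_bounds_of_lt {V : ℝ} (hV : 4.92 < V) :
    130 < Real.exp V ∧ V ^ 2 / 2 - 6 + V ≤ 0.09 * Real.exp V ∧
      2 * V * (V + 0.7) ≤ 1.6 * Real.exp V := by
  have h1 : (130 : ℝ) ≤ Real.exp 4.92 := by
    have h : Real.exp 5 = Real.exp 1 ^ 5 := by rw [Real.exp_one_pow]; norm_num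
    have h5 : (148 : ℝ) ≤ Real.exp 5 := by
      rw [h]
      calc (148 : ℝ) ≤ 2.718 ^ 5 := by norm_num
        _ ≤ _ := pow_le_pow_left₀ (by norm_num) (by linarith [Real.exp_one_gt_d9]) 5
    have h6 : Real.exp 4.92 = Real.exp 5 * Real.exp (-0.08) := by
      rw [← Real.exp_add]
      norm_num
    nlinarith [Real.add_one_le_exp (-0.08)]
  have h2 : 1 + (V - 4.92) + (V - 4.92) ^ 2 / 2 ≤ Real.exp (V - 4.92) :=
    Real.quadratic_le_exp_of_nonneg (by linarith)
  have h3 : Real.exp V = Real.exp 4.92 * Real.exp (V - 4.92) := by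
    rw [← Real.exp_add]
    ring_nf
  have h4 : 130 * (1 + (V - 4.92) + (V - 4.92) ^ 2 / 2) ≤ Real.exp V := by
    rw [h3]
    exact mul_le_mul h1 h2 (by nlinarith) (Real.exp_pos _).le
  refine ⟨by nlinarith, by nlinarith, by nlinarith⟩

/-- The product over the moduli up to `n` is `sieveProd M` with `log M` about `log n - log log n`,
which is where the term `- log log n` comes from. -/
lemma le_prodUpTo_of_large {n : ℕ} (hn : 2 ≤ n) (hV : 4.92 < Real.log (Real.log n)) :
    Real.log n + Real.log (Real.log n) ^ 2 / 2 - Real.log (Real.log n) - 6.1 ≤ prodUpTo n := by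
  by_contra! h
  obtain ⟨h1, h2, h3⟩ := exp_bounds_of_lt hV
  have hS : 0 < Real.log n := Real.log_pos (by exact_mod_cast hn)
  rw [Real.exp_log hS] at h1 h2 h3
  have h4 := log_le_log_moduliUpTo_add hn
  have hA := one_le_prodUpTo n
  set S := Real.log n
  set V := Real.log S
  have h5 : Real.log (prodUpTo n) ≤ V + 0.7 := by
    have := Real.log_le_log (by linarith) (show prodUpTo n ≤ 2 * S by linarith)
    rw [Real.log_mul (by norm_num) hS.ne'] at this
    linarith [Real.log_two_lt_d9]
  set s := Real.log (moduliUpTo n) with hs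
  have h6 : S - (V + 0.7) ≤ s := by linarith
  have h7 : S / 2 ≤ S - (V + 0.7) := by nlinarith
  have h8 : Real.exp 3 ≤ s := by linarith [exp_three_bounds.2]
  have h9 := (barrier_le_sieveProd_and (moduliUpTo n)).1 h8
  have h10 : V - 2 * (V + 0.7) / S ≤ Real.log s := by
    have h11 := Real.log_le_log (by linarith) h6
    have h12 := Real.one_sub_inv_le_log_of_pos (x := (S - (V + 0.7)) / S)
      (div_pos (by linarith) hS)
    rw [Real.log_div (by linarith) hS.ne', inv_div] at h12
    have h13 : S / (S - (V + 0.7)) ≤ 1 + 2 * (V + 0.7) / S := by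
      rw [div_le_iff₀ (by linarith)]
      have h14 : (1 + 2 * (V + 0.7) / S) * (S - (V + 0.7)) =
          S + (V + 0.7) * (S - 2 * (V + 0.7)) / S := by
        field_simp
        ring
      rw [h14]
      have : 0 ≤ (V + 0.7) * (S - 2 * (V + 0.7)) / S :=
        div_nonneg (mul_nonneg (by linarith) (by linarith)) hS.le
      linarith
    linarith
  have h11 : V * (2 * (V + 0.7) / S) ≤ 1.6 := by
    rw [← mul_div_assoc, div_le_iff₀ hS]
    linarith
  have h12 : V ^ 2 - 2 * 1.6 ≤ Real.log s ^ 2 := by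
    have : 0 ≤ V - 2 * (V + 0.7) / S := by nlinarith
    nlinarith [pow_le_pow_left₀ this h10 2, sq_nonneg (2 * (V + 0.7) / S)]
  have h13 := Real.exp_pos (-(Real.log s / 2))
  rw [barrier, ← hs] at h9
  change _ ≤ prodUpTo n at h9
  linarith

lemma mul_lt_luckyNumber_of_large {n : ℕ} (hn : 3 ≤ n) (hV : 4.92 < Real.log (Real.log n)) :
    (n : ℝ) * (Real.log n + Real.log (Real.log n) ^ 2 / 2 - Real.log (Real.log n) - 7.2) <
      luckyNumber n := by
  have hn0 : (0 : ℝ) < n := by exact_mod_cast (by omega)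
  obtain ⟨h1, h2, -⟩ := exp_bounds_of_lt hV
  have hS : 0 < Real.log n := Real.log_pos (by exact_mod_cast (by omega))
  rw [Real.exp_log hS] at h1 h2
  have h3 := le_prodUpTo_of_large (by omega) hV
  have h4 := sub_mul_prodUpTo_le_luckyNumber (show 1 ≤ n by omega)
  have hM0 : (0 : ℝ) < moduliUpTo n := by exact_mod_cast moduliUpTo_pos (by omega)
  have hMn : (moduliUpTo n : ℝ) ≤ n := by
    obtain ⟨m, rfl⟩ : ∃ m, n = m + 1 := ⟨n - 1, by omega⟩
    exact_mod_cast (moduliUpTo_succ_le m).trans m.le_succ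
  -- `n / M ≥ log n - log log n`, where `M` is the number of moduli up to `n`.
  have h5 : Real.log n - Real.log (Real.log n) ≤ (n : ℝ) / moduliUpTo n := by
    have h6 : Real.log (moduliUpTo n) ≤ (n : ℝ) / moduliUpTo n := by
      obtain ⟨m, rfl⟩ : ∃ m, n = m + 1 := ⟨n - 1, by omega⟩
      have := moduliUpTo_mul_log_le (two_le_moduliUpTo hn)
        fun t ht _ => one_add_log_le_prodUpTo ht
      rw [le_div_iff₀ hM0]
      push_cast
      linarith
    have h7 := Real.log_div hn0.ne' hM0.ne'
    rcases le_total (Real.log n) ((n : ℝ) / moduliUpTo n) with hle | hle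
    · linarith
    · have := Real.log_le_log (div_pos hn0 hM0) hle
      linarith
  set S := Real.log n
  set V := Real.log S
  have h6 : S + V ^ 2 / 2 - V - 6.1 ≤ 1.09 * ((n : ℝ) / moduliUpTo n) := by linarith
  have h7 : moduliUpTo n * (S + V ^ 2 / 2 - V - 6.1) ≤ 1.09 * n := by
    have := mul_le_mul_of_nonneg_left h6 hM0.le
    have h8 : (moduliUpTo n : ℝ) * (1.09 * ((n : ℝ) / moduliUpTo n)) = 1.09 * n := by field_simp
    linarith
  have h8 := mul_le_mul_of_nonneg_left h3 (sub_nonneg.2 hMn)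
  linarith

theorem theorem1 :
    (∀ n : ℕ, 1 ≤ n → (luckyNumber n : ℝ) > (n : ℝ) * Real.log (n : ℝ)) ∧
    (∀ n : ℕ, (n : ℝ) > Real.exp (Real.exp (4.92 : ℝ)) →
      (luckyNumber n : ℝ) >
        (n : ℝ) * (Real.log (n : ℝ) + (1 / 2 : ℝ) * (Real.log (Real.log (n : ℝ))) ^ 2
          - Real.log (Real.log (n : ℝ)) - (7.2 : ℝ))) := by
  refine ⟨fun n hn => ?_, fun n hn => ?_⟩
  · have := mul_log_add_one_le_luckyNumber hn fun t ht _ => one_add_log_le_prodUpTo ht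
    linarith
  · have h0 : (0 : ℝ) < n := (Real.exp_pos _).trans hn
    have hS : Real.exp 4.92 < Real.log n := (Real.lt_log_iff_exp_lt h0).2 hn
    have hV : 4.92 < Real.log (Real.log n) :=
      (Real.lt_log_iff_exp_lt ((Real.exp_pos _).trans hS)).2 hS
    have h3 : 3 ≤ n := by
      have h1 := Real.add_one_le_exp (4.92 : ℝ)
      have h2 := Real.add_one_le_exp (Real.exp 4.92)
      have : (3 : ℝ) ≤ n := by linarith
      exact_mod_cast this
    refine lt_of_eq_of_lt ?_ (mul_lt_luckyNumber_of_large h3 hV)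
    ring
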